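/- Let $2^{\mathbb N}$ be the Cantor space with the metric $d(\sigma,\tau)=1/n$, where $n$ is the least positive integer with $\sigma(n)\ne\tau(n)$ (and $d(\sigma,\sigma)=0$), and let $\mathrm{Homeo}(2^{\mathbb N})$ be the group of all homeomorphisms of $2^{\mathbb N}$ onto itself, with the metric $\tilde d(f,g)=\max_\sigma d(f(\sigma),g(\sigma))$. Let $h$ be an element of the comeager conjugacy class of $\mathrm{Homeo}(2^{\mathbb N})$, i.e. $h\in\mathrm{Homeo}(2^{\mathbb N})$ is such that its conjugacy class $\{g h g^{-1} : g\in \mathrm{Homeo}(2^{\mathbb N})\}$ is comeager in $\mathrm{Homeo}(2^{\mathbb N})$. Then: (a) $h$ has no periodic points, i.e. there are no $x\in 2^{\mathbb N}$ and $n\ge 1$ with $h^n(x)=x$. (b) $R(h)=\Omega(h)=CR(h)$, where - $R(h)$ is the set of recurrent points: those $x$ that belong to their own $\omega$-limit set, i.e. every neighbourhood of $x$ contains $h^n(x)$ for infinitely many $n\in\mathbb N$; - $\Omega(h)$ is the set of nonwandering points: those $x$ such that for every neighbourhood $U$ of $x$ there is $n\ge 1$ with $h^n(U)\cap U\neq\emptyset$;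 - $CR(h)$ is the set of chain recurrent points: those $x$ such that for every $\delta>0$ there are $k\ge 1$ and points $x=x_0,x_1,\dots,x_k=x$ with $d(h(x_i),x_{i+1})\le\delta$ for all $0\le i<k$. (c) $R(h)$ is a Cantor set (a nonempty compact zero-dimensional metrizable space without isolated points) with empty interior in $2^{\mathbb N}$. -/

import Mathlib

open Filter Topology Set

noncomputable section

/-- The set `2^ℕ` of infinite sequences of zeros and ones. -/
def Cantor : Type := ℕ → Bool

namespace Cantor

/-- The product topology on `2^ℕ`, each factor being discrete. -/
abbrev productTopology : TopologicalSpace Cantor :=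
  inferInstanceAs (TopologicalSpace (ℕ → Bool))

open scoped Classical in
/-- `distFun σ τ = 1 / n`, where `n` is the least positive integer such that the `n`-th terms of `σ`
and `τ` differ (the terms being numbered from `1`), and `distFun σ σ = 0`. -/
def distFun (σ τ : Cantor) : ℝ :=
  if h : ∃ i : ℕ, σ i ≠ τ i then 1 / ((Nat.find h : ℝ) + 1) else 0

theorem distFun_self (σ : Cantor) : distFun σ σ = 0 := by
  simp [distFun]

theorem distFun_nonneg (σ τ : Cantor) : 0 ≤ distFun σ τ := by
  unfold distFun
  split_ifs
  · positivity
  · exact le_rfl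

theorem distFun_comm (σ τ : Cantor) : distFun σ τ = distFun τ σ := by
  classical
  by_cases h : ∃ i : ℕ, σ i ≠ τ i
  · have h' : ∃ i : ℕ, τ i ≠ σ i := h.imp fun _ => Ne.symm
    have e : Nat.find h = Nat.find h' := Nat.find_congr' ne_comm
    simp only [distFun, dif_pos h, dif_pos h', e]
  · have h' : ¬ ∃ i : ℕ, τ i ≠ σ i := fun ⟨i, hi⟩ => h ⟨i, hi.symm⟩
    simp only [distFun, dif_neg h, dif_neg h']

theorem distFun_lt_iff (σ τ : Cantor) (n : ℕ) :
    distFun σ τ < 1 / ((n : ℝ) + 1) ↔ ∀ i ≤ n, σ i = τ i := by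
  classical
  unfold distFun
  split_ifs with h
  · rw [one_div_lt_one_div (by positivity) (by positivity), add_lt_add_iff_right, Nat.cast_lt,
      Nat.lt_find_iff]
    simp
  · push Not at h
    exact ⟨fun _ i _ => h i, fun _ => by positivity⟩

theorem eq_of_distFun_eq_zero (σ τ : Cantor) (h : distFun σ τ = 0) : σ = τ := by
  funext i
  exact (distFun_lt_iff σ τ i).1 (by rw [h]; positivity) i le_rfl

theorem distFun_triangle (σ τ ρ : Cantor) : distFun σ ρ ≤ distFun σ τ + distFun τ ρ := by
  classical
  have h1 := distFun_nonneg σ τ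
  have h2 := distFun_nonneg τ ρ
  by_cases h : ∃ i : ℕ, σ i ≠ ρ i
  · have e : distFun σ ρ = 1 / ((Nat.find h : ℝ) + 1) := by simp only [distFun, dif_pos h]
    rw [e]
    by_contra hlt
    have a1 := (distFun_lt_iff σ τ (Nat.find h)).1 (by linarith) _ le_rfl
    have a2 := (distFun_lt_iff τ ρ (Nat.find h)).1 (by linarith) _ le_rfl
    exact Nat.find_spec h (a1.trans a2)
  · have e : distFun σ ρ = 0 := by simp only [distFun, dif_neg h]
    linarith

theorem isOpen_iff_distFun (s : Set Cantor) :
    IsOpen[productTopology] s ↔ ∀ σ ∈ s, ∃ ε > 0, ∀ τ, distFun σ τ < ε → τ ∈ s := by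
  refine Iff.trans (isOpen_pi_iff (ι := ℕ) (A := fun _ => Bool) (s := s)) ?_
  constructor
  · intro H σ hσ
    obtain ⟨I, u, hu, hs⟩ := H σ hσ
    refine ⟨1 / (((I.sup id : ℕ) : ℝ) + 1), by positivity, fun τ hτ => hs fun i hi => ?_⟩
    have h := (distFun_lt_iff σ τ _).1 hτ i (Finset.le_sup (f := id) hi)
    rw [← h]
    exact (hu i hi).2
  · intro H σ hσ
    obtain ⟨ε, hε, h⟩ := H σ hσ
    obtain ⟨n, hn⟩ := exists_nat_one_div_lt hε
    refine ⟨Finset.range (n + 1), fun i => {σ i}, fun i _ => ⟨isOpen_discrete _, rfl⟩, ?_⟩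
    intro τ hτ
    refine h τ (lt_trans ((distFun_lt_iff σ τ n).2 fun i hi => ?_) hn)
    exact (hτ i (by simpa using Nat.lt_succ_of_le hi)).symm

/-- `2^ℕ` with the metric `distFun`; its topology is, by definition, the product topology. -/
instance : MetricSpace Cantor :=
  @MetricSpace.ofDistTopology Cantor productTopology distFun distFun_self distFun_comm
    distFun_triangle isOpen_iff_distFun eq_of_distFun_eq_zero

theorem dist_def (σ τ : Cantor) : dist σ τ = distFun σ τ := rfl

theorem topology_eq : (inferInstance : TopologicalSpace Cantor) = productTopology := rfl

instance : CompactSpace Cantor := inferInstanceAs (CompactSpace (ℕ → Bool))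

/-- The group `Homeo(2^ℕ)` with the metric of uniform convergence
`d(f, g) = max_σ d(f σ, g σ)`. -/
instance : MetricSpace (Cantor ≃ₜ Cantor) :=
  MetricSpace.induced (fun h => (⟨h, h.continuous⟩ : C(Cantor, Cantor)))
    (fun _ _ hfg => Homeomorph.ext fun σ => DFunLike.congr_fun hfg σ) inferInstance

theorem dist_homeo_eq (f g : Cantor ≃ₜ Cantor) : dist f g = ⨆ σ, dist (f σ) (g σ) :=
  ContinuousMap.dist_eq_iSup

end Cantor

/-- `R(f)`: the points `x` that belong to their own `ω`-limit set, that is, are limit points of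
their own forward orbit `(f^n(x))`. -/
def recurrentSet {X : Type*} [TopologicalSpace X] (f : X → X) : Set X :=
  {x | x ∈ omegaLimit atTop (fun n : ℕ => f^[n]) {x}}

/-- `Ω(f)`: the points `x` such that every neighbourhood `U` of `x` meets `f^n(U)` for some
`n ≥ 1`. -/
def nonwanderingSet {X : Type*} [TopologicalSpace X] (f : X → X) : Set X :=
  {x | ∀ U ∈ 𝓝 x, ∃ n : ℕ, 1 ≤ n ∧ ((f^[n] '' U) ∩ U).Nonempty}

/-- `CR(f)`: the points `x` such that for every `δ > 0` there is a finite `δ`-pseudo-orbit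
`x = x₀, x₁, …, x_k = x` with `k ≥ 1`. -/
def chainRecurrentSet {X : Type*} [PseudoMetricSpace X] (f : X → X) : Set X :=
  {x | ∀ δ > 0, ∃ (k : ℕ) (c : ℕ → X), 1 ≤ k ∧ c 0 = x ∧ c k = x ∧
    ∀ i < k, dist (f (c i)) (c (i + 1)) ≤ δ}

/-- A Cantor space: a nonempty compact metrizable space that is zero-dimensional (the clopen sets
form a basis) and has no isolated points. -/
structure IsCantorSpace (X : Type*) [TopologicalSpace X] : Prop where
  nonempty : Nonempty X
  compact : CompactSpace X
  metrizable : TopologicalSpace.MetrizableSpace X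
  zeroDimensional : TopologicalSpace.IsTopologicalBasis {s : Set X | IsClopen s}
  noIsolated : ∀ x : X, ¬ IsOpen {x}

/-- A subset that is a Cantor space in the subspace topology. -/
def IsCantorSet {X : Type*} [TopologicalSpace X] (K : Set X) : Prop :=
  IsCantorSpace K

end

/-! A generic homeomorphism looks, at every scale, like a finite disjoint union of dumbbells: two
loops of equal length `K` joined by a one-way edge, with the space cut into small clopen pieces
labelled by the vertices. Having such labellings with arbitrarily small mesh and arbitrarily large
`K` is a conjugacy-invariant property. Each instance of it is open (a labelling survives small
perturbations) and dense (`dense_setOf_dumbbellLabelling`), so by Baire the comeager class contains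
a map with the property, and hence `h` has it.

Everything is read off the dumbbells. Positions advance by one modulo `K`, so every period is a
multiple of arbitrarily large `K`: there are no periodic points. The sets of positions from some `i`
onwards, outside the left loop, are forward invariant and clopen, hence traps. So a chain recurrent
point lies in a loop, does not leave it within `K` steps, and is then back at its label; this gives
`CR ⊆ R`. Since points do pass from left to right in every component, every piece contains a point
that is not chain recurrent, so the interior is empty. Perfectness follows from closedness of `Ω =
R` and the absence of periodic points. -/

noncomputable section

/-! ### Recurrence notions and clopen traps. -/

section Dynamics

theorem mem_recurrentSet_iff {X : Type*} [PseudoMetricSpace X] {f : X → X} {x : X} :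
    x ∈ recurrentSet f ↔ ∀ ε > 0, ∀ N : ℕ, ∃ n ≥ N, dist (f^[n] x) x < ε := by
  change x ∈ omegaLimit atTop (fun n : ℕ => f^[n]) {x} ↔ _
  rw [mem_omegaLimit_iff_frequently, Metric.nhds_basis_ball.forall_iff]
  · simp only [singleton_inter_nonempty, mem_preimage, Metric.mem_ball, frequently_atTop]
  · intro s t hst h
    exact h.mono fun n hn => hn.mono (inter_subset_inter_right _ (preimage_mono hst))

theorem recurrentSet_subset_nonwanderingSet {X : Type*} [PseudoMetricSpace X] (f : X → X) :
    recurrentSet f ⊆ nonwanderingSet f := by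
  intro x hx U hU
  obtain ⟨ε, hε, hU'⟩ := Metric.mem_nhds_iff.1 hU
  obtain ⟨n, hn, h⟩ := mem_recurrentSet_iff.1 hx ε hε 1
  exact ⟨n, hn, _, mem_image_of_mem _ (mem_of_mem_nhds hU), hU' h⟩

theorem nonwanderingSet_subset_chainRecurrentSet {X : Type*} [PseudoMetricSpace X] {f : X → X}
    (hf : Continuous f) : nonwanderingSet f ⊆ chainRecurrentSet f := by
  intro x hx δ hδ
  obtain ⟨η, hη, h⟩ := Metric.continuousAt_iff.1 (hf.continuousAt (x := x)) (δ / 2) (by positivity)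
  obtain ⟨n, hn, _, ⟨y, hy, rfl⟩, hy'⟩ :=
    hx _ (Metric.ball_mem_nhds x (lt_min hη (half_pos hδ)))
  rw [Metric.mem_ball, lt_min_iff] at hy hy'
  -- The true orbit segment of `y` with both ends replaced by `x`; each replacement costs at most `δ
  -- / 2`, and both may affect one step when `n = 1`.
  refine ⟨n, fun i => if i = 0 ∨ i = n then x else f^[i] y, hn, by simp, by simp, fun i hi => ?_⟩
  have h1 : dist (f (if i = 0 ∨ i = n then x else f^[i] y)) (f^[i + 1] y) ≤ δ / 2 := by
    rw [Function.iterate_succ_apply']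
    by_cases h0 : i = 0
    · simpa [h0, dist_comm] using (h hy.1).le
    · simp [h0, hi.ne, (half_pos hδ).le]
  have h2 : dist (f^[i + 1] y) (if i + 1 = 0 ∨ i + 1 = n then x else f^[i + 1] y) ≤ δ / 2 := by
    by_cases hn' : i + 1 = n
    · simpa [hn'] using hy'.2.le
    · simp [hn', (half_pos hδ).le]
  linarith [dist_triangle (f (if i = 0 ∨ i = n then x else f^[i] y)) (f^[i + 1] y)
    (if i + 1 = 0 ∨ i + 1 = n then x else f^[i + 1] y)]

theorem isClosed_nonwanderingSet {X : Type*} [TopologicalSpace X] (f : X → X) :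
    IsClosed (nonwanderingSet f) := by
  rw [← isOpen_compl_iff, isOpen_iff_mem_nhds]
  intro x hx
  simp only [nonwanderingSet, mem_compl_iff, mem_ofPred_eq, not_forall] at hx
  obtain ⟨U, hU, h⟩ := hx
  filter_upwards [eventually_mem_nhds_iff.2 hU] with y hy hy'
  exact h (hy' U hy)

/-- Pigeonhole: an infinite orbit visits some member of a finite cover by wandering neighbourhoods
twice. -/
theorem nonwanderingSet_nonempty {X : Type*} [TopologicalSpace X] [CompactSpace X] [Nonempty X]
    (f : X → X) : (nonwanderingSet f).Nonempty := by
  by_contra hemp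
  have H : ∀ x, ∃ U ∈ 𝓝 x, ∀ n : ℕ, 1 ≤ n → ¬ ((f^[n] '' U) ∩ U).Nonempty := by
    intro x
    by_contra hx
    push Not at hx
    exact hemp ⟨x, fun U hU => hx U hU⟩
  choose U hU hUn using H
  obtain ⟨t, ht⟩ := CompactSpace.elim_nhds_subcover U hU
  obtain ⟨x⟩ := ‹Nonempty X›
  have hc : ∀ n : ℕ, ∃ y : t, f^[n] x ∈ U y := by
    intro n
    have := ht.ge (mem_univ (f^[n] x))
    simpa using this
  choose c hc using hc
  obtain ⟨i, j, hij, he⟩ : ∃ i j, i < j ∧ c i = c j := by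
    obtain ⟨i, j, hij, he⟩ := Finite.exists_ne_map_eq_of_infinite c
    rcases hij.lt_or_gt with h | h
    exacts [⟨i, j, h, he⟩, ⟨j, i, h, he.symm⟩]
  refine hUn (c i) (j - i) (by omega) ⟨f^[j] x, ⟨f^[i] x, hc i, ?_⟩, he ▸ hc j⟩
  rw [← Function.iterate_add_apply, Nat.sub_add_cancel hij.le]

theorem map_mem_recurrentSet {X : Type*} [PseudoMetricSpace X] {f : X → X} (hf : Continuous f)
    {x : X} (hx : x ∈ recurrentSet f) : f x ∈ recurrentSet f := by
  rw [mem_recurrentSet_iff] at hx ⊢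
  intro ε hε N
  obtain ⟨η, hη, h⟩ := Metric.continuousAt_iff.1 (hf.continuousAt (x := x)) ε hε
  obtain ⟨n, hn, hd⟩ := hx η hη N
  refine ⟨n, hn, ?_⟩
  rw [← Function.iterate_succ_apply, Function.iterate_succ_apply']
  exact h hd

/-- A closed set of recurrent points without periodic points is perfect. -/
theorem isCantorSet_recurrentSet {X : Type*} [MetricSpace X] [CompactSpace X] [Nonempty X]
    [TotallyDisconnectedSpace X] {f : X → X} (hf : Continuous f)
    (hper : Function.periodicPts f = ∅) (hR : recurrentSet f = nonwanderingSet f) :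
    IsCantorSet (recurrentSet f) := by
  have hclosed : IsClosed (recurrentSet f) := hR ▸ isClosed_nonwanderingSet f
  have hcomp : CompactSpace (recurrentSet f) := isCompact_iff_compactSpace.1 hclosed.isCompact
  refine ⟨(hR ▸ nonwanderingSet_nonempty f).to_subtype, hcomp, inferInstance,
    isTopologicalBasis_isClopen, ?_⟩
  rintro ⟨x, hx⟩ ho
  obtain ⟨ε, hε, hb⟩ := Metric.isOpen_iff.1 ho _ rfl
  obtain ⟨n, hn, hd⟩ := mem_recurrentSet_iff.1 hx ε hε 1
  have hmem : f^[n] x ∈ recurrentSet f := by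
    clear hn hd
    induction n with
    | zero => exact hx
    | succ n ih => rw [Function.iterate_succ_apply']; exact map_mem_recurrentSet hf ih
  have heq : f^[n] x = x := congrArg Subtype.val (hb (show ⟨f^[n] x, hmem⟩ ∈ _ from hd))
  have : x ∈ Function.periodicPts f := ⟨n, hn, heq⟩
  simp [hper] at this

theorem IsClopen.exists_dist_le {X : Type*} [PseudoMetricSpace X] [CompactSpace X] {A : Set X}
    (hA : IsClopen A) : ∃ δ > 0, ∀ x ∈ A, ∀ y, dist x y ≤ δ → y ∈ A := by
  obtain ⟨δ, hδ, h⟩ :=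
    hA.isClosed.isCompact.exists_cthickening_subset_open hA.isOpen Subset.rfl
  refine ⟨δ, hδ, fun x hx y hxy => h ?_⟩
  exact Metric.mem_cthickening_of_dist_le y x δ A hx (by rwa [dist_comm])

/-- A chain recurrent point that eventually enters a forward invariant clopen set lies in it. -/
theorem mem_of_iterate_mem_of_mem_chainRecurrentSet {X : Type*} [PseudoMetricSpace X]
    [CompactSpace X] {f : X → X} (hf : Continuous f) {x : X} (hx : x ∈ chainRecurrentSet f)
    {A : Set X} (hA : IsClopen A) (hfA : MapsTo f A A) (n : ℕ) (hn : f^[n] x ∈ A) : x ∈ A := by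
  induction n generalizing A with
  | zero => exact hn
  | succ n ih =>
    rw [Function.iterate_succ_apply'] at hn
    -- The induction hypothesis is applied to the trap `f ⁻¹' A`. Once `f x ∈ A`, a pseudo-orbit
    -- from `x` with steps finer than the room around `A` stays in `A` after its first step, so it
    -- can only return to `x` if `x ∈ A`.
    have hfx : f x ∈ A := ih (hA.preimage hf) (fun y hy => hfA hy) hn
    obtain ⟨δ, hδ, h⟩ := hA.exists_dist_le
    obtain ⟨k, c, hk, h0, hk', hc⟩ := hx δ hδ
    have : ∀ i < k, c (i + 1) ∈ A := by
      intro i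
      induction i with
      | zero => exact fun hi => h (f (c 0)) (by rwa [h0]) _ (hc 0 hi)
      | succ i ihi =>
        exact fun hi => h _ (hfA (ihi (by omega))) _ (hc _ hi)
    have := this (k - 1) (by omega)
    rwa [Nat.sub_add_cancel hk, hk'] at this

/-- The orbit of a chain recurrent point does not come from outside a forward invariant clopen
set containing the point. -/
theorem mem_of_mem_iterate_of_mem_chainRecurrentSet {X : Type*} [PseudoMetricSpace X]
    [CompactSpace X] (f : X ≃ₜ X) {x : X} {A : Set X} (hA : IsClopen A) (hfA : MapsTo f A A)
    (n : ℕ) (hx : f^[n] x ∈ chainRecurrentSet f) (hn : f^[n] x ∈ A) : x ∈ A := by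
  have hcoe : ∀ y, (f ^ n : X ≃ₜ X) y = f^[n] y := fun y => by
    clear hx hn
    induction n generalizing y with
    | zero => rfl
    | succ n ih => rw [pow_succ, Function.iterate_succ_apply, ← ih]; rfl
  have hclopen : IsClopen (f^[n] '' A) := by
    have : f^[n] = (f ^ n : X ≃ₜ X) := (funext hcoe).symm
    rw [this, Homeomorph.image_eq_preimage_symm]
    exact hA.preimage (f ^ n : X ≃ₜ X).symm.continuous
  have hmaps : MapsTo f (f^[n] '' A) (f^[n] '' A) := by
    rintro _ ⟨y, hy, rfl⟩
    exact ⟨f y, hfA hy, by rw [← Function.iterate_succ_apply, Function.iterate_succ_apply']⟩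
  -- The image `f^[n] '' A` is itself a trap, and the `n`-th iterate of `f^[n] x` lies in it.
  obtain ⟨y, hy, hyx⟩ := mem_of_iterate_mem_of_mem_chainRecurrentSet f.continuous hx hclopen hmaps n
    (mem_image_of_mem _ hn)
  exact f.injective.iterate n hyx ▸ hy

end Dynamics

/-! ### Dumbbell labellings and their dynamical consequences. -/

section Dumbbells

/-- A locally constant labelling of the points of `X` by the vertices of a disjoint union of
dumbbells, compatible with `f`. Each dumbbell has vertices `0, …, M - 1`; its left loop is
`0, …, K - 1`, its right loop is `M - K, …, M - 1`, and the edge from `K - 1` to `K`, which leads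
out of the left loop, is realized in each component. -/
structure DumbbellLabelling {X : Type*} [TopologicalSpace X] (f : X → X) where
  ι : Type
  comp : X → ι
  pos : X → ℕ
  K : ℕ
  M : ℕ
  two_mul_le : 2 * K ≤ M
  pos_lt : ∀ x, pos x < M
  isLocallyConstant_comp : IsLocallyConstant comp
  isLocallyConstant_pos : IsLocallyConstant pos
  comp_map : ∀ x, comp (f x) = comp x
  pos_map : ∀ x, pos (f x) = pos x + 1 ∨ (pos x + 1 = K ∧ pos (f x) = 0) ∨
    (pos x + 1 = M ∧ pos (f x) + K = M)
  exists_exit : ∀ x, ∃ y, comp y = comp x ∧ pos y + 1 = K ∧ pos (f y) = K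

namespace DumbbellLabelling

/-- Points with equal labels are at distance less than `ε`. -/
def MeshLT {X : Type*} [PseudoMetricSpace X] {f : X → X} (L : DumbbellLabelling f) (ε : ℝ) : Prop :=
  ∀ x y, L.comp x = L.comp y → L.pos x = L.pos y → dist x y < ε

section

variable {X : Type*} [TopologicalSpace X] {f : X → X} (L : DumbbellLabelling f)

/-- The labelling carried over by a conjugacy. -/
def conj {Y : Type*} [TopologicalSpace Y] (g : Y ≃ₜ X) :
    DumbbellLabelling (fun y => g.symm (f (g y))) where
  ι := L.ι
  comp := L.comp ∘ g
  pos := L.pos ∘ g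
  K := L.K
  M := L.M
  two_mul_le := L.two_mul_le
  pos_lt y := L.pos_lt (g y)
  isLocallyConstant_comp := L.isLocallyConstant_comp.comp_continuous g.continuous
  isLocallyConstant_pos := L.isLocallyConstant_pos.comp_continuous g.continuous
  comp_map y := by simpa using L.comp_map (g y)
  pos_map y := by simpa using L.pos_map (g y)
  exists_exit y := by
    obtain ⟨x, hx⟩ := L.exists_exit (g y)
    exact ⟨g.symm x, by simpa using hx⟩

/-- The labelling of a nearby map. -/
def ofEq {f' : X → X} (hc : ∀ x, L.comp (f' x) = L.comp (f x))
    (hp : ∀ x, L.pos (f' x) = L.pos (f x)) : DumbbellLabelling f' where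
  ι := L.ι
  comp := L.comp
  pos := L.pos
  K := L.K
  M := L.M
  two_mul_le := L.two_mul_le
  pos_lt := L.pos_lt
  isLocallyConstant_comp := L.isLocallyConstant_comp
  isLocallyConstant_pos := L.isLocallyConstant_pos
  comp_map x := by rw [hc, L.comp_map]
  pos_map x := by rw [hp]; exact L.pos_map x
  exists_exit x := by simpa only [hp] using L.exists_exit x

theorem comp_iterate (n : ℕ) (x : X) : L.comp (f^[n] x) = L.comp x := by
  induction n with
  | zero => rfl
  | succ n ih => rw [Function.iterate_succ_apply', L.comp_map, ih]

/-- Both loops have length `K`, so closing either one changes nothing modulo `K`. -/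
theorem pos_map_modEq (x : X) : L.pos (f x) ≡ L.pos x + 1 [MOD L.K] := by
  rcases L.pos_map x with h | ⟨h, h'⟩ | ⟨h, h'⟩
  · rw [h]
  · rw [h, h']
    exact (Nat.modEq_zero_iff_dvd.2 dvd_rfl).symm
  · rw [h, ← h']
    exact (Nat.add_modEq_right (n := L.K)).symm

theorem pos_iterate_modEq (n : ℕ) (x : X) : L.pos (f^[n] x) ≡ L.pos x + n [MOD L.K] := by
  induction n with
  | zero => rfl
  | succ n ih =>
    rw [Function.iterate_succ_apply']
    exact (L.pos_map_modEq _).trans (ih.add_right 1)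

theorem dvd_of_iterate_eq {n : ℕ} {x : X} (h : f^[n] x = x) : L.K ∣ n := by
  have := L.pos_iterate_modEq n x
  rw [h] at this
  exact (Nat.modEq_zero_iff_dvd).1 (Nat.ModEq.add_left_cancel' (L.pos x) this.symm)

theorem isClopen_le_pos (i : ℕ) : IsClopen {x | i ≤ L.pos x} :=
  ⟨⟨L.isLocallyConstant_pos {j | i ≤ j}ᶜ⟩, L.isLocallyConstant_pos {j | i ≤ j}⟩

theorem mapsTo_le_pos {i : ℕ} (hi : L.K ≤ i) (hi' : i + L.K ≤ L.M) :
    MapsTo f {x | i ≤ L.pos x} {x | i ≤ L.pos x} := by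
  intro x (hx : i ≤ L.pos x)
  change i ≤ L.pos (f x)
  rcases L.pos_map x with h | ⟨h, h'⟩ | ⟨h, h'⟩ <;> omega

end

section

variable {X : Type*} [PseudoMetricSpace X] [CompactSpace X]

/-- A trap excludes escape from the left loop, and another excludes positions strictly between the
loops. Each loop consists of `K` consecutive positions, so the congruence modulo `K` determines the
position. -/
theorem pos_iterate_K {f : X → X} (hf : Continuous f) (L : DumbbellLabelling f) {x : X}
    (hx : x ∈ chainRecurrentSet f) : L.pos (f^[L.K] x) = L.pos x := by
  have hmod : L.pos (f^[L.K] x) ≡ L.pos x [MOD L.K] :=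
    (L.pos_iterate_modEq L.K x).trans (Nat.add_modEq_right)
  have h2 := L.two_mul_le
  by_cases hl : L.pos x < L.K
  · refine hmod.eq_of_lt_of_lt (not_le.1 fun h => ?_) hl
    exact hl.not_ge (mem_of_iterate_mem_of_mem_chainRecurrentSet hf hx (L.isClopen_le_pos L.K)
      (L.mapsTo_le_pos le_rfl (by omega)) L.K h)
  · have hr : L.M ≤ L.pos x + L.K := by
      by_contra hr
      have hmem : f^[1] x ∈ {y | L.pos x + 1 ≤ L.pos y} := by
        change L.pos x + 1 ≤ L.pos (f x)
        rcases L.pos_map x with h | ⟨h, h'⟩ | ⟨h, h'⟩ <;> omega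
      have := mem_of_iterate_mem_of_mem_chainRecurrentSet hf hx (L.isClopen_le_pos (L.pos x + 1))
        (L.mapsTo_le_pos (by omega) (by omega)) 1 hmem
      exact absurd this (Nat.not_succ_le_self _)
    have hr' : L.M - L.K ≤ L.pos (f^[L.K] x) := by
      have := (L.mapsTo_le_pos (i := L.M - L.K) (by omega) (by omega)).iterate L.K
      exact this (show L.M - L.K ≤ L.pos x by omega)
    have h1 := L.pos_lt x
    have h3 := L.pos_lt (f^[L.K] x)
    generalize L.pos (f^[L.K] x) = a at *
    generalize L.pos x = b at *
    obtain ⟨a, rfl⟩ := Nat.exists_eq_add_of_le hr'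
    obtain ⟨b, rfl⟩ := Nat.exists_eq_add_of_le (show L.M - L.K ≤ b by omega)
    rw [(Nat.ModEq.add_left_cancel' _ hmod).eq_of_lt_of_lt (by omega) (by omega)]

/-- The orbit of a point crossing the exit edge passes through every position: backwards around the
left loop, forwards along the edge and the right loop. It crosses into a trap, so none of its points
is chain recurrent. -/
theorem exists_notMem_chainRecurrentSet (f : X ≃ₜ X) (L : DumbbellLabelling f) (x : X) :
    ∃ z, L.comp z = L.comp x ∧ L.pos z = L.pos x ∧ z ∉ chainRecurrentSet f := by
  have h2 := L.two_mul_le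
  obtain ⟨y, hyc, hy, hy'⟩ := L.exists_exit x
  by_cases hl : L.pos x < L.K
  · obtain ⟨n, hn⟩ : ∃ n, L.pos x + n = L.pos y := ⟨L.pos y - L.pos x, by omega⟩
    have hsurj := f.surjective.iterate n
    obtain ⟨z, rfl⟩ := hsurj y
    have hlz : L.pos z < L.K := by
      by_contra h
      have := (L.mapsTo_le_pos (i := L.K) le_rfl (by omega)).iterate n (not_lt.1 h)
      have : L.K ≤ L.pos (f^[n] z) := this
      omega
    refine ⟨z, by rw [← hyc, L.comp_iterate], ?_, fun hz => hlz.not_ge ?_⟩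
    · have := L.pos_iterate_modEq n z
      rw [← hn] at this
      exact (this.add_right_cancel' n).symm.eq_of_lt_of_lt hlz hl
    · refine mem_of_iterate_mem_of_mem_chainRecurrentSet f.continuous hz (L.isClopen_le_pos L.K)
        (L.mapsTo_le_pos le_rfl (by omega)) (n + 1) ?_
      change L.K ≤ L.pos (f^[n + 1] z)
      rw [Function.iterate_succ_apply', hy']
  · have hpos : ∀ n, L.pos y + (n + 1) < L.M → L.pos (f^[n + 1] y) = L.pos y + (n + 1) := by
      intro n
      induction n with
      | zero => intro _; change L.pos (f y) = _; omega
      | succ n ih =>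
        intro hn
        have := ih (by omega)
        rw [Function.iterate_succ_apply']
        rcases L.pos_map (f^[n + 1] y) with h | ⟨h, h'⟩ | ⟨h, h'⟩ <;> omega
    have hxM := L.pos_lt x
    obtain ⟨n, hn⟩ : ∃ n, L.pos x = L.pos y + (n + 1) := ⟨L.pos x - L.K, by omega⟩
    have hn' := hpos n (by omega)
    refine ⟨f^[n + 1] y, by rw [L.comp_iterate, hyc], by rw [hn', hn], fun hz => ?_⟩
    by_cases hr : L.M ≤ L.pos x + L.K
    · have : L.M - L.K ≤ L.pos y := mem_of_mem_iterate_of_mem_chainRecurrentSet f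
        (L.isClopen_le_pos (L.M - L.K)) (L.mapsTo_le_pos (by omega) (by omega)) (n + 1) hz
        (show L.M - L.K ≤ L.pos (f^[n + 1] y) by omega)
      omega
    · have : L.K ≤ L.pos y := mem_of_mem_iterate_of_mem_chainRecurrentSet f
        (L.isClopen_le_pos L.K) (L.mapsTo_le_pos le_rfl (by omega)) (n + 1) hz
        (show L.K ≤ L.pos (f^[n + 1] y) by omega)
      omega

end

end DumbbellLabelling

/-- `f` admits dumbbell labellings of arbitrarily small mesh with arbitrarily long loops. -/
def HasDumbbellLabellings {X : Type*} [PseudoMetricSpace X] (f : X → X) : Prop :=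
  ∀ ε > 0, ∀ m : ℕ, ∃ L : DumbbellLabelling f, L.MeshLT ε ∧ m ≤ L.K

namespace HasDumbbellLabellings

theorem conj {X Y : Type*} [PseudoMetricSpace X] [PseudoMetricSpace Y] [CompactSpace X] {f : X → X}
    (hf : HasDumbbellLabellings f) (g : Y ≃ₜ X) :
    HasDumbbellLabellings (fun y => g.symm (f (g y))) := by
  intro ε hε m
  obtain ⟨δ, hδ, h⟩ := Metric.uniformContinuous_iff.1
    (CompactSpace.uniformContinuous_of_continuous g.symm.continuous) ε hε
  obtain ⟨L, hL, hm⟩ := hf δ hδ m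
  refine ⟨L.conj g, fun x y hc hp => ?_, hm⟩
  simpa using h (hL (g x) (g y) hc hp)

theorem periodicPts_eq_empty {X : Type*} [PseudoMetricSpace X] {f : X → X}
    (hf : HasDumbbellLabellings f) : Function.periodicPts f = ∅ := by
  refine eq_empty_of_forall_notMem fun x ⟨n, hn, hx⟩ => ?_
  obtain ⟨L, -, hm⟩ := hf 1 one_pos (n + 1)
  have := Nat.le_of_dvd hn (L.dvd_of_iterate_eq hx)
  omega

theorem chainRecurrentSet_subset_recurrentSet {X : Type*} [PseudoMetricSpace X] [CompactSpace X]
    {f : X → X} (hf : HasDumbbellLabellings f) (hc : Continuous f) :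
    chainRecurrentSet f ⊆ recurrentSet f := by
  refine fun x hx => mem_recurrentSet_iff.2 fun ε hε N => ?_
  obtain ⟨L, hL, hm⟩ := hf ε hε N
  exact ⟨L.K, hm, hL _ _ (L.comp_iterate _ _) (L.pos_iterate_K hc hx)⟩

theorem interior_chainRecurrentSet {X : Type*} [PseudoMetricSpace X] [CompactSpace X]
    {f : X ≃ₜ X} (hf : HasDumbbellLabellings f) : interior (chainRecurrentSet f) = ∅ := by
  refine eq_empty_of_forall_notMem fun x hx => ?_
  obtain ⟨ε, hε, hb⟩ := Metric.mem_nhds_iff.1 (mem_interior_iff_mem_nhds.1 hx)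
  obtain ⟨L, hL, -⟩ := hf ε hε 0
  obtain ⟨z, hzc, hzp, hz⟩ := L.exists_notMem_chainRecurrentSet f x
  exact hz (hb (hL z x hzc hzp))

end HasDumbbellLabellings

end Dumbbells

/-! ### The homeomorphism group is a Baire space. -/

section Baire

/-- The self-homeomorphisms of a compact space embed as a closed subset of the pairs of mutually
inverse continuous maps. -/
theorem Cantor.isClosedEmbedding_homeo :
    IsClosedEmbedding (fun h : Cantor ≃ₜ Cantor =>
      ((⟨h, h.continuous⟩, ⟨h.symm, h.symm.continuous⟩) : C(Cantor, Cantor) × C(Cantor, Cantor))) := by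
  have h1 : IsInducing (fun h : Cantor ≃ₜ Cantor => (⟨h, h.continuous⟩ : C(Cantor, Cantor))) :=
    ⟨rfl⟩
  have h2 : Continuous
      (fun h : Cantor ≃ₜ Cantor => (⟨h.symm, h.symm.continuous⟩ : C(Cantor, Cantor))) := by
    rw [Metric.continuous_iff]
    intro f ε hε
    obtain ⟨δ, hδ, h⟩ := Metric.uniformContinuous_iff.1
      (CompactSpace.uniformContinuous_of_continuous f.symm.continuous) ε hε
    refine ⟨δ, hδ, fun g hg => (ContinuousMap.dist_lt_iff hε).2 fun y => ?_⟩
    have hg' : dist (g (g.symm y)) (f (g.symm y)) < δ :=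
      ((ContinuousMap.dist_lt_iff hδ).1 hg) (g.symm y)
    have := h hg'
    simpa [dist_comm] using this
  refine ⟨⟨?_, ?_⟩, ?_⟩
  · exact .of_comp (h1.continuous.prodMk h2) continuous_fst h1
  · exact fun f g hfg => Homeomorph.ext fun x => DFunLike.congr_fun (congrArg Prod.fst hfg) x
  · have : (range fun h : Cantor ≃ₜ Cantor =>
      ((⟨h, h.continuous⟩, ⟨h.symm, h.symm.continuous⟩) : C(Cantor, Cantor) × C(Cantor, Cantor))) =
        {p | p.1.comp p.2 = .id _} ∩ {p | p.2.comp p.1 = .id _} := by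
      ext ⟨a, b⟩
      constructor
      · rintro ⟨h, hh⟩
        obtain ⟨rfl, rfl⟩ := Prod.mk.inj hh
        exact ⟨ContinuousMap.ext fun x => h.apply_symm_apply x,
          ContinuousMap.ext fun x => h.symm_apply_apply x⟩
      · rintro ⟨h, h'⟩
        exact ⟨⟨⟨a, b, fun x => DFunLike.congr_fun h' x, fun x => DFunLike.congr_fun h x⟩,
          a.continuous, b.continuous⟩, rfl⟩
    rw [this]
    exact (isClosed_eq (continuous_fst.compCM continuous_snd) continuous_const).inter
      (isClosed_eq (continuous_snd.compCM continuous_fst) continuous_const)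

/-- The uniform metric is not complete, since a uniform limit of homeomorphisms need not be
injective; recording inverses as well repairs this. -/
instance Cantor.baireSpace_homeo : BaireSpace (Cantor ≃ₜ Cantor) := by
  have : CompleteSpace Cantor := complete_of_compact
  have := Cantor.isClosedEmbedding_homeo.IsCompletelyMetrizableSpace
  infer_instance

end Baire

/-! ### Homeomorphisms realizing finite graphs, and dumbbells in finite graphs. -/

section Construction

namespace Cantor

instance : Nonempty Cantor := ⟨fun _ => false⟩

/-- The first `N` terms and the remaining ones. -/
def splitAt (N : ℕ) : Cantor ≃ₜ (Fin N → Bool) × Cantor where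
  toFun x := (fun i => x i, fun n => x (N + n))
  invFun p := fun n => if h : n < N then p.1 ⟨n, h⟩ else p.2 (n - N)
  left_inv x := by
    funext n
    by_cases h : n < N
    · simp [h]
    · simp [h, Nat.add_sub_cancel' (not_lt.1 h)]
  right_inv p := by
    refine Prod.ext (funext fun i => by simp) (funext fun n => by simp)
  continuous_toFun := by
    refine .prodMk (continuous_pi fun i => ?_) (continuous_pi (A := fun _ => Bool) fun n => ?_)
    · exact continuous_apply (A := fun _ : ℕ => Bool) (i : ℕ)
    · exact continuous_apply (A := fun _ : ℕ => Bool) (N + n)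
  continuous_invFun := by
    refine continuous_pi (A := fun _ => Bool) fun n => ?_
    by_cases h : n < N
    · simp only [h, dite_true]
      exact (continuous_apply _).comp continuous_fst
    · simp only [h, dite_false]
      exact (continuous_apply (A := fun _ : ℕ => Bool) (n - N)).comp continuous_snd

theorem dist_lt_of_splitAt_eq {N : ℕ} {x y : Cantor}
    (h : (splitAt (N + 1) x).1 = (splitAt (N + 1) y).1) : dist x y < 1 / ((N : ℝ) + 1) := by
  rw [dist_def, distFun_lt_iff]
  exact fun i hi => congrFun h ⟨i, Nat.lt_succ_of_le hi⟩

/-- Two copies of the Cantor space make up a Cantor space. -/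
def sumHomeo : Cantor ⊕ Cantor ≃ₜ Cantor :=
  let e : Cantor ⊕ Cantor ≃ₜ Bool × Cantor :=
    { toEquiv := (Equiv.boolProdEquivSum Cantor).symm
      continuous_toFun := by
        refine continuous_sum_dom.2 ⟨?_, ?_⟩
        · exact continuous_const.prodMk continuous_id
        · exact continuous_const.prodMk continuous_id
      continuous_invFun := by
        refine continuous_prod_of_discrete_left.2 fun b => ?_
        cases b
        · exact continuous_inl
        · exact continuous_inr }
  (e.trans ((Homeomorph.funUnique (Fin 1) Bool).symm.prodCongr (Homeomorph.refl _))).trans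
    (splitAt 1).symm

theorem nonempty_homeo_fin_prod (n : ℕ) : Nonempty (Cantor ≃ₜ Fin (n + 1) × Cantor) := by
  induction n with
  | zero => exact ⟨(Homeomorph.uniqueProd (Fin 1) Cantor).symm⟩
  | succ n ih =>
    obtain ⟨e⟩ := ih
    have e1 : Fin (n + 2) ≃ₜ Fin (n + 1) ⊕ Fin 1 :=
      (finSumFinEquiv (m := n + 1) (n := 1)).symm.toHomeomorphOfDiscrete
    exact ⟨((e1.prodCongr (Homeomorph.refl _)).trans
      ((Homeomorph.sumProdDistrib).trans ((e.symm.sumCongr (Homeomorph.uniqueProd _ _)).trans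
        sumHomeo))).symm⟩

theorem nonempty_homeo_prod (F : Type*) [TopologicalSpace F] [DiscreteTopology F] [Finite F]
    [Nonempty F] : Nonempty (Cantor ≃ₜ F × Cantor) := by
  obtain ⟨n, ⟨e⟩⟩ := Finite.exists_equiv_fin F
  cases n with
  | zero => exact (e (Classical.arbitrary F)).elim0
  | succ n =>
    obtain ⟨e'⟩ := nonempty_homeo_fin_prod n
    exact ⟨e'.trans (e.symm.toHomeomorphOfDiscrete.prodCongr (Homeomorph.refl _))⟩

/-- The copy of the Cantor space over `a` is split into as many copies as `φ` has points over `a`.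
-/
theorem exists_homeo_prod_over {A B : Type*} [TopologicalSpace A] [DiscreteTopology A]
    [TopologicalSpace B] [DiscreteTopology B] [Finite B] {φ : B → A} (hφ : Function.Surjective φ) :
    ∃ Φ : A × Cantor ≃ₜ B × Cantor, ∀ z, φ (Φ z).1 = z.1 := by
  have (a : A) : Nonempty {b // φ b = a} := let ⟨b, hb⟩ := hφ a; ⟨⟨b, hb⟩⟩
  let Ψ (a : A) : Cantor ≃ₜ {b // φ b = a} × Cantor := (nonempty_homeo_prod {b // φ b = a}).some
  refine ⟨⟨⟨fun z => ((Ψ z.1 z.2).1.1, (Ψ z.1 z.2).2),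
    fun w => (φ w.1, (Ψ (φ w.1)).symm (⟨w.1, rfl⟩, w.2)), fun z => ?_, fun w => ?_⟩, ?_, ?_⟩, ?_⟩
  · obtain ⟨a, x⟩ := z
    have key : ∀ (a' : A) (p : {b // φ b = a'} × Cantor),
        (Ψ (φ p.1.1)).symm (⟨p.1.1, rfl⟩, p.2) = (Ψ a').symm p := by
      rintro _ ⟨⟨b, rfl⟩, y⟩
      rfl
    refine Prod.ext (Ψ a x).1.2 ?_
    exact (key a (Ψ a x)).trans ((Ψ a).symm_apply_apply x)
  · simp
  · refine continuous_prod_of_discrete_left.2 fun a => ?_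
    exact (continuous_subtype_val.comp (continuous_fst.comp (Ψ a).continuous)).prodMk
      (continuous_snd.comp (Ψ a).continuous)
  · refine continuous_prod_of_discrete_left.2 fun b => ?_
    have h : Continuous fun y : Cantor => ((⟨b, rfl⟩, y) : {b' // φ b' = φ b} × Cantor) :=
      continuous_const.prodMk continuous_id
    exact (show Continuous fun _ : Cantor => φ b from continuous_const).prodMk
      ((Ψ (φ b)).symm.continuous.comp h)
  · rintro ⟨a, x⟩
    exact (Ψ a x).1.2

/-- Given a finite clopen partition of the Cantor space, with label space `V`, and a finite graph
`E ⇉ Λ` over `V` all of whose vertices have outgoing and ingoing edges, the partition can be refined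
to one labelled by `Λ` so that some homeomorphism moves the pieces along the edges, using all
edges. -/
theorem exists_homeo_of_graph {V Λ E : Type*} [TopologicalSpace V] [DiscreteTopology V]
    [TopologicalSpace Λ] [DiscreteTopology Λ] [Finite Λ] [TopologicalSpace E] [DiscreteTopology E]
    [Finite E] (c : Cantor ≃ₜ V × Cantor) {π : Λ → V} (hπ : Function.Surjective π) {s t : E → Λ}
    (hs : Function.Surjective s) (ht : Function.Surjective t) :
    ∃ (f : Cantor ≃ₜ Cantor) (l : Cantor → Λ) (e : Cantor → E), Continuous l ∧
      Function.Surjective e ∧ ∀ x, π (l x) = (c x).1 ∧ s (e x) = l x ∧ t (e x) = l (f x) := by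
  obtain ⟨P, hP⟩ := exists_homeo_prod_over hπ
  obtain ⟨S, hS⟩ := exists_homeo_prod_over hs
  obtain ⟨T, hT⟩ := exists_homeo_prod_over ht
  -- Each vertex piece is divided among its outgoing edges by `S` and among its ingoing edges by
  -- `T`; going out along `S` and back in along `T.symm` moves points along edges.
  let Q := c.trans P
  refine ⟨(Q.trans S).trans (T.symm.trans Q.symm), fun x => (Q x).1, fun x => (S (Q x)).1,
    continuous_fst.comp Q.continuous,
    Prod.fst_surjective.comp (S.surjective.comp Q.surjective), fun x => ⟨hP _, hS _, ?_⟩⟩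
  simpa [Q] using hT (T.symm (S (Q x)))

end Cantor

/-- Every vertex of a finite graph without sources and sinks lies on the image of a dumbbell. -/
theorem exists_dumbbell_paths {W : Type*} [Finite W] {G : W → W → Prop} (hout : ∀ w, ∃ w', G w w')
    (hin : ∀ w, ∃ w', G w' w) (m : ℕ) :
    ∃ (K M : ℕ) (p : W → ℕ → W), m ≤ K ∧ 0 < K ∧ 2 * K ≤ M ∧ (∀ w, ∃ i < M, p w i = w) ∧
      (∀ w i, i + 1 < M → G (p w i) (p w (i + 1))) ∧ (∀ w, G (p w (K - 1)) (p w 0)) ∧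
      ∀ w, G (p w (M - 1)) (p w (M - K)) := by
  choose s hs using hout
  choose t ht using hin
  have hper : ∀ u : W → W, ∃ n k, 0 < k ∧ ∀ a ≥ n, ∀ j, u^[a + j * k] = u^[a] := by
    intro u
    obtain ⟨i, j, hij, he⟩ : ∃ i j, i < j ∧ u^[i] = u^[j] := by
      obtain ⟨i, j, hij, he⟩ := Finite.exists_ne_map_eq_of_infinite fun n => u^[n]
      rcases hij.lt_or_gt with h | h
      exacts [⟨i, j, h, he⟩, ⟨j, i, h, he.symm⟩]
    obtain ⟨k, rfl⟩ := Nat.exists_eq_add_of_lt hij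
    have h1 : ∀ a ≥ i, u^[a + (k + 1)] = u^[a] := by
      intro a ha
      obtain ⟨b, rfl⟩ := Nat.exists_eq_add_of_le' ha
      rw [add_assoc, Function.iterate_add, Function.iterate_add u b i, he, ← add_assoc]
    refine ⟨i, k + 1, k.succ_pos, fun a ha j => ?_⟩
    induction j with
    | zero => simp
    | succ j ih => rw [Nat.succ_mul, ← add_assoc, h1 _ (by omega), ih]
  obtain ⟨n, k, hk, hsk⟩ := hper s
  obtain ⟨n', k', hk', htk⟩ := hper t
  obtain ⟨a, ha, ha'⟩ : ∃ a, n ≤ a ∧ n' ≤ a := ⟨max n n', le_max_left _ _, le_max_right _ _⟩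
  -- Iterates of the chosen successor `s` and predecessor `t` are periodic from `a` on, and `K` is a
  -- common period. The path for `w` has `w` in position `a + K`, its `t`-history before and its
  -- `s`-future after; periodicity closes a loop of length `K` at each end.
  obtain ⟨K, hK, hm, hKs, hKt⟩ :
      ∃ K, 0 < K ∧ m ≤ K ∧ s^[a + K] = s^[a] ∧ t^[a + K] = t^[a] := by
    have hkk := Nat.mul_pos hk hk'
    refine ⟨(m + 1) * (k * k'), by positivity, by nlinarith, ?_, ?_⟩
    · convert hsk a ha ((m + 1) * k') using 3
      ring
    · convert htk a ha' ((m + 1) * k) using 3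
      ring
  refine ⟨K, 2 * (a + K), fun w i => if i ≤ a + K then t^[a + K - i] w else s^[i - (a + K)] w,
    hm, hK, by omega, fun w => ⟨a + K, by omega, by simp⟩, fun w i hi => ?_, fun w => ?_,
    fun w => ?_⟩
  · beta_reduce
    rcases lt_trichotomy i (a + K) with h | rfl | h
    · obtain ⟨j, hj⟩ := Nat.exists_eq_add_of_lt h
      rw [if_pos h.le, if_pos (by omega), show a + K - i = j + 1 by omega,
        show a + K - (i + 1) = j by omega, Function.iterate_succ_apply']
      exact ht _
    · simpa using hs w
    · rw [if_neg (by omega), if_neg (by omega), Nat.succ_sub h.le, Function.iterate_succ_apply']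
      exact hs _
  · beta_reduce
    rw [if_pos (by omega), if_pos (by omega), show a + K - (K - 1) = a + 1 by omega, Nat.sub_zero,
      hKt, Function.iterate_succ_apply']
    exact ht _
  · have hlast : (if 2 * (a + K) - K ≤ a + K then t^[a + K - (2 * (a + K) - K)] w
        else s^[2 * (a + K) - K - (a + K)] w) = s^[a] w := by
      split_ifs with h
      · obtain rfl : a = 0 := by omega
        simp [show K - (2 * K - K) = 0 by omega]
      · congr 2
        omega
    beta_reduce
    rw [hlast, ← hKs]
    obtain ⟨b, hb⟩ : ∃ b, a + K = b + 1 := ⟨a + K - 1, by omega⟩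
    split_ifs with h
    · obtain ⟨rfl⟩ : b = 0 := by omega
      rw [hb]
      exact hs w
    · rw [hb, show 2 * (b + 1) - 1 - (b + 1) = b by omega, Function.iterate_succ_apply']
      exact hs _

end Construction

/-! ### Dumbbell labellings are generic. -/

section Genericity

theorem IsLocallyConstant.exists_dist_lt {X Y : Type*} [PseudoMetricSpace X] [CompactSpace X]
    {l : X → Y} (hl : IsLocallyConstant l) : ∃ δ > 0, ∀ x y, dist x y < δ → l x = l y := by
  obtain ⟨δ, hδ, h⟩ := lebesgue_number_lemma_of_metric (isCompact_univ (X := X))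
    (c := fun i : Y => l ⁻¹' {i}) (fun i => hl {i}) (fun x _ => mem_iUnion.2 ⟨l x, rfl⟩)
  refine ⟨δ, hδ, fun x y hxy => ?_⟩
  obtain ⟨i, hi⟩ := h x trivial
  have hx : l x = i := hi (Metric.mem_ball_self hδ)
  have hy : l y = i := hi (by rwa [Metric.mem_ball, dist_comm])
  rw [hx, hy]

namespace Cantor

theorem dist_apply_le (f g : Cantor ≃ₜ Cantor) (x : Cantor) : dist (f x) (g x) ≤ dist f g :=
  ContinuousMap.dist_apply_le_dist (f := ⟨f, f.continuous⟩) (g := ⟨g, g.continuous⟩) x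

theorem isOpen_setOf_dumbbellLabelling (ε : ℝ) (m : ℕ) :
    IsOpen {f : Cantor ≃ₜ Cantor | ∃ L : DumbbellLabelling f, L.MeshLT ε ∧ m ≤ L.K} := by
  rw [Metric.isOpen_iff]
  rintro f ⟨L, hL, hm⟩
  obtain ⟨δ, hδ, h⟩ := L.isLocallyConstant_comp.exists_dist_lt
  obtain ⟨δ', hδ', h'⟩ := L.isLocallyConstant_pos.exists_dist_lt
  refine ⟨min δ δ', lt_min hδ hδ', fun g hg => ?_⟩
  have hgf (x : Cantor) := lt_min_iff.1 ((dist_apply_le g f x).trans_lt hg)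
  exact ⟨L.ofEq (fun x => h _ _ (hgf x).1) (fun x => h' _ _ (hgf x).2), hL, hm⟩

/-- Cylinders, with the transitions realized by `f`, form a finite graph `G`. Lifting it to one
dumbbell through each cylinder and realizing the lift by a homeomorphism `g` gives a map whose
transitions are all transitions of `f`, so `g` is close to `f`. -/
theorem dense_setOf_dumbbellLabelling {ε : ℝ} (hε : 0 < ε) (m : ℕ) :
    Dense {f : Cantor ≃ₜ Cantor | ∃ L : DumbbellLabelling f, L.MeshLT ε ∧ m ≤ L.K} := by
  rw [Metric.dense_iff]
  intro f r hr
  obtain ⟨δ, hδ, hf⟩ := Metric.uniformContinuous_iff.1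
    (CompactSpace.uniformContinuous_of_continuous f.continuous) (r / 4) (by positivity)
  obtain ⟨N, hN⟩ := exists_nat_one_div_lt (lt_min hε (lt_min hδ (show 0 < r / 4 by positivity)))
  obtain ⟨hN1, hN2, hN3⟩ := by simpa only [lt_min_iff] using hN
  have hclose {x y : Cantor} (h : (splitAt (N + 1) x).1 = (splitAt (N + 1) y).1) :=
    dist_lt_of_splitAt_eq h
  let c (x : Cantor) : Fin (N + 1) → Bool := (splitAt (N + 1) x).1
  have hc : Function.Surjective c := Prod.fst_surjective.comp (splitAt (N + 1)).surjective
  let G (w w' : Fin (N + 1) → Bool) : Prop := ∃ y, c y = w ∧ c (f y) = w'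
  obtain ⟨K, M, p, hm, hK, hKM, hp, hG, hGl, hGr⟩ := exists_dumbbell_paths (G := G)
    (fun w => let ⟨y, hy⟩ := hc w; ⟨_, y, hy, rfl⟩)
    (fun w => let ⟨y, hy⟩ := hc w; ⟨_, f.symm y, rfl, by simpa using hy⟩) m
  let Step (i j : ℕ) : Prop := j = i + 1 ∨ (i + 1 = K ∧ j = 0) ∨ (i + 1 = M ∧ j + K = M)
  let E := {e : (Fin (N + 1) → Bool) × Fin M × Fin M // Step e.2.1 e.2.2}
  let s (e : E) : (Fin (N + 1) → Bool) × Fin M := (e.1.1, e.1.2.1)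
  let t (e : E) : (Fin (N + 1) → Bool) × Fin M := (e.1.1, e.1.2.2)
  have hs : Function.Surjective s := by
    rintro ⟨w, i, hi⟩
    by_cases h : i + 1 < M
    · exact ⟨⟨(w, ⟨i, hi⟩, ⟨i + 1, h⟩), Or.inl rfl⟩, rfl⟩
    · exact ⟨⟨(w, ⟨i, hi⟩, ⟨M - K, by omega⟩),
        Or.inr (Or.inr ⟨by simp only; omega, by simp only; omega⟩)⟩, rfl⟩
  have ht : Function.Surjective t := by
    rintro ⟨w, j, hj⟩
    rcases j with _ | j
    · exact ⟨⟨(w, ⟨K - 1, by omega⟩, ⟨0, hj⟩),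
        Or.inr (Or.inl ⟨by simp only; omega, rfl⟩)⟩, rfl⟩
    · exact ⟨⟨(w, ⟨j, by omega⟩, ⟨j + 1, hj⟩), Or.inl rfl⟩, rfl⟩
  obtain ⟨g, l, e, hl, he, h⟩ := exists_homeo_of_graph (splitAt (N + 1))
    (π := fun z : (Fin (N + 1) → Bool) × Fin M => p z.1 z.2)
    (fun w => let ⟨i, hi, h⟩ := hp w; ⟨(w, ⟨i, hi⟩), h⟩) hs ht
  have hstep (x : Cantor) : (l (g x)).1 = (l x).1 ∧ Step (l x).2 (l (g x)).2 := by
    rw [← (h x).2.1, ← (h x).2.2]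
    exact ⟨rfl, (e x).2⟩
  have hedge (w : Fin (N + 1) → Bool) {i j : ℕ} (hj : j < M) (hij : Step i j) :
      G (p w i) (p w j) := by
    rcases hij with rfl | ⟨h, rfl⟩ | ⟨h, h'⟩
    · exact hG w i hj
    · obtain rfl : i = K - 1 := by omega
      exact hGl w
    · obtain rfl : i = M - 1 := by omega
      obtain rfl : j = M - K := by omega
      exact hGr w
  have hloc : IsLocallyConstant l := IsLocallyConstant.iff_continuous _ |>.2 hl
  refine ⟨g, ?_, ⟨⟨_, fun x => (l x).1, fun x => (l x).2, K, M, hKM, fun x => (l x).2.2,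
    hloc.comp Prod.fst, hloc.comp fun z => (z.2 : ℕ), fun x => (hstep x).1, fun x => (hstep x).2,
    fun x => ?_⟩, fun x y hx hy => ?_, hm⟩⟩
  · have : dist g f ≤ r / 4 + r / 4 := by
      refine (ContinuousMap.dist_le (by positivity)).2 fun x => ?_
      obtain ⟨y, hy, hy'⟩ := hedge (l x).1 (l (g x)).2.2 (hstep x).2
      have h1 : dist x y < δ := (hclose ((h x).1.symm.trans hy.symm)).trans hN2
      have h2 : dist (g x) (f y) < r / 4 := by
        refine (hclose ((h (g x)).1.symm.trans ?_)).trans hN3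
        rw [(hstep x).1]
        exact hy'.symm
      have h3 := hf h1
      have := dist_triangle (g x) (f y) (f x)
      rw [dist_comm (f y)] at this
      change dist (g x) (f x) ≤ _
      linarith
    exact this.trans_lt (by linarith)
  -- Since `g` uses every edge, some point crosses the exit edge of the given dumbbell.
  · obtain ⟨y, hy⟩ := he ⟨((l x).1, ⟨K - 1, by omega⟩, ⟨K, by omega⟩),
      Or.inl (by simp only; omega)⟩
    have h1 := (h y).2.1
    have h2 := (h y).2.2
    rw [hy] at h1 h2
    refine ⟨y, ?_, ?_, ?_⟩
    · rw [← h1]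
    · rw [← h1]
      exact Nat.sub_add_cancel hK
    · rw [← h2]
  · refine (hclose ?_).trans hN1
    rw [← (h x).1, ← (h y).1]
    exact congrArg₂ (fun w i => p w i) hx hy

theorem setOf_hasDumbbellLabellings_mem_residual :
    {f : Cantor ≃ₜ Cantor | HasDumbbellLabellings f} ∈ residual (Cantor ≃ₜ Cantor) := by
  have : ∀ n : ℕ, {f : Cantor ≃ₜ Cantor |
      ∃ L : DumbbellLabelling f, L.MeshLT (1 / ((n : ℝ) + 1)) ∧ n ≤ L.K} ∈ residual _ := fun n =>
    residual_of_dense_open (isOpen_setOf_dumbbellLabelling _ n)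
      (dense_setOf_dumbbellLabelling (by positivity) n)
  filter_upwards [countable_iInter_mem.2 this] with f hf ε hε m
  obtain ⟨N, hN⟩ := exists_nat_one_div_lt hε
  -- A single index controls both the mesh and the loop length.
  obtain ⟨L, hL, hm⟩ := mem_iInter.1 hf (max N m)
  refine ⟨L, fun x y hc hp => (hL x y hc hp).trans_le (le_trans ?_ hN.le),
    (le_max_right _ _).trans hm⟩
  exact one_div_le_one_div_of_le (by positivity) (by push_cast; gcongr; exact le_max_left _ _)

theorem hasDumbbellLabellings_of_conjugatesOf_mem_residual {h : Cantor ≃ₜ Cantor}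
    (hh : conjugatesOf h ∈ residual (Cantor ≃ₜ Cantor)) : HasDumbbellLabellings h := by
  obtain ⟨f, hf, hhf⟩ := (dense_of_mem_residual
    (inter_mem setOf_hasDumbbellLabellings_mem_residual hh)).nonempty
  obtain ⟨g, rfl⟩ := isConj_iff.1 (show IsConj h f from hhf)
  convert HasDumbbellLabellings.conj hf g using 1
  funext x
  change h x = g.symm (g (h (g.symm (g x))))
  simp

instance : TotallyDisconnectedSpace Cantor :=
  inferInstanceAs (TotallyDisconnectedSpace (ℕ → Bool))

end Cantor

end Genericity

end

theorem mainTheorem9 (h : Cantor ≃ₜ Cantor)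
    (hh : conjugatesOf h ∈ residual (Cantor ≃ₜ Cantor)) :
    Function.periodicPts h = ∅ ∧
    (recurrentSet h = nonwanderingSet h ∧ nonwanderingSet h = chainRecurrentSet h) ∧
    (IsCantorSet (recurrentSet h) ∧ interior (recurrentSet h) = ∅) := by
  have hD := Cantor.hasDumbbellLabellings_of_conjugatesOf_mem_residual hh
  have hRΩ := recurrentSet_subset_nonwanderingSet h
  have hΩC := nonwanderingSet_subset_chainRecurrentSet h.continuous
  have hCR := hD.chainRecurrentSet_subset_recurrentSet h.continuous
  have hR : recurrentSet h = nonwanderingSet h := hRΩ.antisymm (hΩC.trans hCR)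
  refine ⟨hD.periodicPts_eq_empty, ⟨hR, hΩC.antisymm (hCR.trans hRΩ)⟩,
    isCantorSet_recurrentSet h.continuous hD.periodicPts_eq_empty hR, ?_⟩
  rw [hCR.antisymm' (hRΩ.trans hΩC)]
  exact hD.interior_chainRecurrentSet
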